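/- **Setting.** A finite quantum system consists of a finite-dimensional complex Hilbert space $\mathcal K$, the $*$-algebra $\mathcal O_{\mathcal K}$ of all linear maps on $\mathcal K$, a self-adjoint Hamiltonian $H$ and a faithful state (density matrix) $\omega>0$, $\operatorname{tr}\omega=1$. Put $\tau^t(A)=e^{itH}Ae^{-itH}$, $\omega_t=\omega\circ\tau^t$ (density matrix $e^{-itH}\omega e^{itH}$), $\sigma=-i[H,\log\omega]$ and $$e_{2,t}(\alpha)=\log\operatorname{tr}\big(\omega^{(1-\alpha)/2}\,\omega_t^{\alpha}\,\omega^{(1-\alpha)/2}\big).$$ The system is time-reversal invariant (TRI) if there is an anti-linear $*$-automorphism $\Theta$ of $\mathcal O_{\mathcal K}$ with $\Theta\circ\Theta=\mathrm{id}$, $\tau^t\circ\Theta=\Theta\circ\tau^{-t}$ for all $t\in\mathbb R$, and $\omega(\Theta(A))=\omega(A^*)$ for all $A$. Let $(\mathcal Q_M)_{M\in\mathbb N}$ be a sequence of TRI finite quantum systems (objects of $\mathcal Q_M$ carry the index $M$), and let $\mathcal O$ be a unital $C^*$-algebra with a $C^*$-dynamics $\tau^t$ (a group of $*$-automorphisms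 such that $t\mapsto\tau^t(A)$ is norm continuous for every $A\in\mathcal O$) and a state $\omega$. Assume the thermodynamic-limit assumptions: * (A1) for every $M$ there is a faithful representation (injective $*$-homomorphism) $\pi_M:\mathcal O_{\mathcal K_M}\to\mathcal O$, and $\pi_M(\mathcal O_{\mathcal K_M})\subset\pi_{M+1}(\mathcal O_{\mathcal K_{M+1}})$; * (A2) $\mathcal O_{\rm loc}=\bigcup_M\pi_M(\mathcal O_{\mathcal K_M})$ is dense in $\mathcal O$; * (A3) for $A\in\mathcal O_{\rm loc}$, $\lim_{M\to\infty}\omega_M(\pi_M^{-1}(A))=\omega(A)$ and $\lim_{M\to\infty}\pi_M\circ\tau_M^t\circ\pi_M^{-1}(A)=\tau^t(A)$, uniformly for $t$ in compact subsets of $\mathbb R$; * (A4) $\lim_{M\to\infty}\pi_M(\sigma_M)=\sigma$ exists in the norm of $\mathcal O$; * (A6) for all $t,\alpha\in\mathbb R$ the limit $e_{2,t}(\alpha)=\lim_{M\to\infty}e_{M,2,t}(\alpha)$ exists and is finite; and the large-time assumption: * (A9) the limit $e_{2,+}(\alpha)=\lim_{t\to\infty}\frac1t e_{2,t}(\alpha)$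 exists and is finite for all $\alpha$ in some open interval $\mathcal I\supset[0,1]$, and $e_{2,+}$ is differentiable on $\mathcal I$. For $p\in\,]0,1[$ let $$D_{M,p}(t)=\inf_P\big[\,p\,\omega_{M,t/2}(\mathbb 1-P)+(1-p)\,\omega_{M,-t/2}(P)\,\big],$$ the infimum being over all orthogonal projections $P\in\mathcal O_{\mathcal K_M}$, be the minimal error probability in distinguishing $\omega_{M,t/2}$ (a priori probability $p$) from $\omega_{M,-t/2}$ (a priori probability $1-p$). Define $\underline D_p(t)=\liminf_{M\to\infty}D_{M,p}(t)$, $\overline D_p(t)=\limsup_{M\to\infty}D_{M,p}(t)$ and the Chernoff error exponents $$\underline d_p=\liminf_{t\to\infty}\frac1t\log\underline D_p(t),\qquad \overline d_p=\limsup_{t\to\infty}\frac1t\log\overline D_p(t)$$ in $[-\infty,\infty]$, with $\log 0=-\infty$. **Theorem.** For every $p\in\,]0,1[$, $$\underline d_p=\overline d_p=\inf_{\alpha\in[0,1]}e_{2,+}(\alpha),$$ and the infimum is attained at $\alpha=1/2$. -/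

import Mathlib

open Filter Topology
open scoped ComplexOrder

noncomputable section

/-! ### Finite quantum systems -/

/-- A finite quantum system on the finite dimensional Hilbert space `K`: the algebra of observables
is `K →L[ℂ] K`, the dynamics is generated by the Hamiltonian, and the reference state is a faithful
state, identified with its density matrix. -/
structure FiniteQuantumSystem (K : Type*) [NormedAddCommGroup K] [InnerProductSpace ℂ K]
    [CompleteSpace K] [FiniteDimensional ℂ K] where
  /-- the Hamiltonian `H` -/
  hamiltonian : K →L[ℂ] K
  /-- the density matrix `ω` of the reference state -/
  state : K →L[ℂ] K
  isSelfAdjoint_hamiltonian : IsSelfAdjoint hamiltonian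
  state_nonneg : 0 ≤ state
  trace_state : LinearMap.trace ℂ K (state : K →ₗ[ℂ] K) = 1
  faithful : ∀ ψ : K, state ψ = 0 → ψ = 0

section Finite

variable {K : Type*} [NormedAddCommGroup K] [InnerProductSpace ℂ K] [CompleteSpace K]
  [FiniteDimensional ℂ K]

/-- The trace on the algebra of observables. -/
def opTrace (A : K →L[ℂ] K) : ℂ := LinearMap.trace ℂ K (A : K →ₗ[ℂ] K)

namespace FiniteQuantumSystem

variable (Q : FiniteQuantumSystem K)

/-- Heisenberg dynamics `τ^t(A) = e^{itH} A e^{-itH}`. -/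
def evolve (t : ℝ) (A : K →L[ℂ] K) : K →L[ℂ] K :=
  NormedSpace.exp ((Complex.I * (t : ℂ)) • Q.hamiltonian) * A *
    NormedSpace.exp ((-(Complex.I * (t : ℂ))) • Q.hamiltonian)

/-- The state `ω_t = ω ∘ τ^t`, whose density matrix is `τ^{-t}(ω) = e^{-itH} ω e^{itH}`. -/
def stateAt (t : ℝ) : K →L[ℂ] K := Q.evolve (-t) Q.state

/-- The expectation `ω(A) = tr(ω A)`. -/
def expectation (A : K →L[ℂ] K) : ℂ := opTrace (Q.state * A)

/-- The entropy production observable `σ = -i [H, log ω]`. -/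
def entropyProduction : K →L[ℂ] K :=
  (-Complex.I) • (Q.hamiltonian * CFC.log Q.state - CFC.log Q.state * Q.hamiltonian)

/-- The entropic pressure functional
`e_{p,t}(α) = log tr [(ω^{(1-α)/p} ω_t^{2α/p} ω^{(1-α)/p})^{p/2}]`, for real `p ≥ 1`. -/
def entropicPressure (p t α : ℝ) : ℝ :=
  Real.log (opTrace ((Q.state ^ ((1 - α) / p) * Q.stateAt t ^ (2 * α / p) *
    Q.state ^ ((1 - α) / p)) ^ (p / 2))).re

/-- Time-reversal invariance: there is an involutive anti-linear `*`-automorphism `Θ` of the algebra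
of observables with `τ^t ∘ Θ = Θ ∘ τ^{-t}` and `ω(Θ(A)) = ω(A^*)`. -/
def IsTRI : Prop :=
  ∃ Θ : (K →L[ℂ] K) →ₛₗ[starRingEnd ℂ] (K →L[ℂ] K),
    (∀ A B, Θ (A * B) = Θ A * Θ B) ∧
    (∀ A, Θ (star A) = star (Θ A)) ∧
    (∀ A, Θ (Θ A) = A) ∧
    (∀ t A, Q.evolve t (Θ A) = Θ (Q.evolve (-t) A)) ∧
    (∀ A, Q.expectation (Θ A) = Q.expectation (star A))

end FiniteQuantumSystem

/-- The error probability `D_p(ρ, ν, P) = p ρ(1 - P) + (1 - p) ν(P)` of the test `P`, where the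
system is in the state `ρ` with probability `p` and in the state `ν` with probability `1 - p`. -/
def testError (p : ℝ) (ρ ν P : K →L[ℂ] K) : ℝ :=
  p * (opTrace (ρ * (1 - P))).re + (1 - p) * (opTrace (ν * P)).re

/-- The minimal error probability `D_p(ρ, ν)`: the infimum of the error probability over all tests,
a test being an orthogonal projection. -/
def minError (p : ℝ) (ρ ν : K →L[ℂ] K) : ℝ :=
  ⨅ P : {P : K →L[ℂ] K // IsStarProjection P}, testError p ρ ν P

/-- The minimal error probability `D_p(t)` in distinguishing `ω_{t/2}` (a priori probability `p`)
from `ω_{-t/2}` (a priori probability `1 - p`). -/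
def FiniteQuantumSystem.arrowError (Q : FiniteQuantumSystem K) (p t : ℝ) : ℝ :=
  minError p (Q.stateAt (t / 2)) (Q.stateAt (-t / 2))

end Finite

/-! ### Extended systems and the thermodynamic limit -/

/-- A `C^*`-dynamics: a norm continuous group of `*`-automorphisms. -/
structure IsCStarDynamics {O : Type*} [CStarAlgebra O] (τ : ℝ → (O ≃⋆ₐ[ℂ] O)) : Prop where
  map_zero : ∀ A, τ 0 A = A
  map_add : ∀ s t A, τ (s + t) A = τ s (τ t A)
  continuous : ∀ A, Continuous fun t => τ t A

/-- A state: a positive normalized linear functional. -/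
structure IsState {O : Type*} [CStarAlgebra O] (ω : O →ₗ[ℂ] ℂ) : Prop where
  nonneg : ∀ A, 0 ≤ ω (star A * A)
  map_one : ω 1 = 1

section Limit

variable {K : ℕ → Type*} [∀ M, NormedAddCommGroup (K M)] [∀ M, InnerProductSpace ℂ (K M)]
  [∀ M, CompleteSpace (K M)] [∀ M, FiniteDimensional ℂ (K M)]

/-- The extended system `(O, τ, ω)` is the thermodynamic limit of the finite systems `Q M`, realized
through the faithful representations `π M` (not assumed to preserve the unit). On the range of `π M`
the map `Function.invFun (π M)` is the inverse of `π M`; for a given local observable it is relevant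
only for large `M`. -/
structure IsThermodynamicLimit (Q : ∀ M, FiniteQuantumSystem (K M))
    {O : Type*} [CStarAlgebra O] (τ : ℝ → (O ≃⋆ₐ[ℂ] O)) (ω : O →ₗ[ℂ] ℂ)
    (π : ∀ M, (K M →L[ℂ] K M) →⋆ₙₐ[ℂ] O) : Prop where
  isCStarDynamics : IsCStarDynamics τ
  isState : IsState ω
  injective : ∀ M, Function.Injective (π M)
  range_subset : ∀ M, Set.range (π M) ⊆ Set.range (π (M + 1))
  /-- the local observables are dense -/
  dense : Dense (⋃ M, Set.range (π M))
  tendsto_state : ∀ A ∈ ⋃ M, Set.range (π M),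
    Tendsto (fun M => (Q M).expectation (Function.invFun (π M) A)) atTop (𝓝 (ω A))
  tendsto_dynamics : ∀ A ∈ ⋃ M, Set.range (π M), ∀ S : Set ℝ, IsCompact S →
    TendstoUniformlyOn (fun M t => π M ((Q M).evolve t (Function.invFun (π M) A)))
      (fun t => τ t A) atTop S
  /-- the entropy production observables converge in norm -/
  tendsto_entropyProduction : ∃ σ : O,
    Tendsto (fun M => π M (Q M).entropyProduction) atTop (𝓝 σ)

/-- The lower Chernoff exponent
`liminf_{t → ∞} (1/t) log (liminf_{M → ∞} D_{M,p}(t))`, as an extended real number (`log 0 = -∞`). -/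
def lowerChernoff (Q : ∀ M, FiniteQuantumSystem (K M)) (p : ℝ) : EReal :=
  liminf (fun t : ℝ => ((1 / t : ℝ) : EReal) *
    ENNReal.log (ENNReal.ofReal (liminf (fun M => (Q M).arrowError p t) atTop))) atTop

/-- The upper Chernoff exponent
`limsup_{t → ∞} (1/t) log (limsup_{M → ∞} D_{M,p}(t))`, as an extended real number (`log 0 = -∞`). -/
def upperChernoff (Q : ∀ M, FiniteQuantumSystem (K M)) (p : ℝ) : EReal :=
  limsup (fun t : ℝ => ((1 / t : ℝ) : EReal) *
    ENNReal.log (ENNReal.ofReal (limsup (fun M => (Q M).arrowError p t) atTop))) atTop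

end Limit

end

/-! Write `ρ = ω_{t/2}`, `ν = ω_{-t/2}`. Cyclicity and invariance of the trace give `exp e_{2,t}(α)
= tr(ρ^α ν^(1-α))`. Time reversal makes this symmetric under `α ↦ 1 - α`; with Cauchy–Schwarz over
pairs of eigenvectors, `α = 1/2` is then a minimum.

Upper bound: Powers–Størmer (`exists_projection_trace_le`) bounds the error by the value at `1/2`.

Lower bound: every test errs by at least a constant times a sum of `min(l, m)` over pairs of
eigenvalues of `ρ` and `ν`, weighted by overlaps (`min_mul_sum_le_testError`). Where `|log(l/m)| ≤
c`, this minimum is at least `e^{-c/2} √(lm)`; the other pairs are controlled by the tilted values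
at `1/2 ± s` times `e^{-sc}` (`exp_mul_rpow_le_min`). Take `c = δt`. As the derivative of `e_{2,+}`
vanishes at the interior minimum `1/2`, some `s > 0` makes the tilted terms exponentially
negligible, so the loss in the rate is at most `δ`, which is arbitrary. -/

noncomputable section

set_option linter.unusedSectionVars false

/-! ### Trace and functional calculus in finite dimension -/

section FiniteDimensional

variable {K : Type*} [NormedAddCommGroup K] [InnerProductSpace ℂ K] [CompleteSpace K]
  [FiniteDimensional ℂ K]

theorem opTrace_add (A B : K →L[ℂ] K) : opTrace (A + B) = opTrace A + opTrace B := by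
  simp [opTrace]

theorem opTrace_sub (A B : K →L[ℂ] K) : opTrace (A - B) = opTrace A - opTrace B := by
  simp [opTrace]

theorem opTrace_smul (c : ℂ) (A : K →L[ℂ] K) : opTrace (c • A) = c * opTrace A := by
  simp [opTrace]

theorem opTrace_mul_comm (A B : K →L[ℂ] K) : opTrace (A * B) = opTrace (B * A) :=
  LinearMap.trace_mul_comm ℂ (A : K →ₗ[ℂ] K) (B : K →ₗ[ℂ] K)

theorem opTrace_eq_sum_inner {ι : Type*} [Fintype ι] (b : OrthonormalBasis ι ℂ K)
    (A : K →L[ℂ] K) : opTrace A = ∑ i, inner ℂ (b i) (A (b i)) :=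
  LinearMap.trace_eq_sum_inner _ b

theorem opTrace_star (A : K →L[ℂ] K) : opTrace (star A) = starRingEnd ℂ (opTrace A) := by
  rw [opTrace_eq_sum_inner (stdOrthonormalBasis ℂ K), opTrace_eq_sum_inner (stdOrthonormalBasis ℂ K),
    map_sum]
  refine Finset.sum_congr rfl fun i _ => ?_
  rw [ContinuousLinearMap.star_eq_adjoint, ContinuousLinearMap.adjoint_inner_right,
    inner_conj_symm]

theorem opTrace_nonneg {A : K →L[ℂ] K} (hA : 0 ≤ A) : 0 ≤ opTrace A := by
  rw [opTrace_eq_sum_inner (stdOrthonormalBasis ℂ K)]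
  rw [ContinuousLinearMap.nonneg_iff_isPositive] at hA
  exact Finset.sum_nonneg fun i _ => hA.inner_nonneg_right _

theorem opTrace_mul_nonneg {A B : K →L[ℂ] K} (hA : 0 ≤ A) (hB : 0 ≤ B) : 0 ≤ opTrace (A * B) := by
  have hs : IsSelfAdjoint (CFC.sqrt A) := (CFC.sqrt_nonneg A).isSelfAdjoint
  rw [← CFC.sqrt_mul_sqrt_self A hA, mul_assoc, opTrace_mul_comm]
  exact opTrace_nonneg (hs.conjugate_nonneg hB)

/-- If `A` and `B` are diagonal in the orthonormal bases `e` and `f`, the trace of `A * B` is the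
sum of the products of eigenvalues weighted by the transition probabilities. -/
theorem opTrace_mul_eq_sum {ι κ : Type*} [Fintype ι] [Fintype κ] (e : OrthonormalBasis ι ℂ K)
    (f : OrthonormalBasis κ ℂ K) {A B : K →L[ℂ] K} (hA : IsSelfAdjoint A) {a : ι → ℝ} {b : κ → ℝ}
    (hAe : ∀ i, A (e i) = (a i : ℂ) • e i) (hBf : ∀ j, B (f j) = (b j : ℂ) • f j) :
    (opTrace (A * B)).re = ∑ j, ∑ i, ‖inner ℂ (e i) (f j)‖ ^ 2 * (a i * b j) := by
  rw [opTrace_eq_sum_inner f, Complex.re_sum]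
  refine Finset.sum_congr rfl fun j _ => ?_
  have h1 : inner ℂ (f j) ((A * B) (f j)) = ∑ i, ((‖inner ℂ (e i) (f j)‖ ^ 2 * (a i * b j) : ℝ) : ℂ) := by
    rw [mul_apply_eq_comp, hBf, map_smul, inner_smul_right, ← e.sum_inner_mul_inner,
      Finset.mul_sum]
    refine Finset.sum_congr rfl fun i _ => ?_
    have h2 : inner ℂ (e i) (A (f j)) = (a i : ℂ) * inner ℂ (e i) (f j) := by
      have h := ContinuousLinearMap.adjoint_inner_left A (f j) (e i)
      rw [← ContinuousLinearMap.star_eq_adjoint, hA.star_eq, hAe, inner_smul_left] at h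
      simpa using h.symm
    rw [h2]
    have h3 : inner ℂ (f j) (e i) * inner ℂ (e i) (f j) = ((‖inner ℂ (e i) (f j)‖ ^ 2 : ℝ) : ℂ) := by
      rw [← inner_conj_symm (f j) (e i), Complex.conj_mul']
      push_cast
      rfl
    push_cast at h3 ⊢
    linear_combination (a i * b j : ℂ) * h3
  rw [h1, ← Complex.ofReal_sum, Complex.ofReal_re]

theorem finite_spectrum_real (A : K →L[ℂ] K) : (spectrum ℝ A).Finite := by
  have h : (spectrum ℂ A).Finite := by
    rw [← AlgEquiv.spectrum_eq (Module.End.toContinuousLinearMap K).symm A]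
    exact Module.End.finite_spectrum _
  refine (h.preimage (f := algebraMap ℝ ℂ) Complex.ofReal_injective.injOn).subset fun x hx => ?_
  exact (spectrum.algebraMap_mem_iff ℂ).2 hx

/-- The spectrum is finite, so on it any `f`, continuous or not, agrees with a Lagrange
interpolation polynomial, and for polynomials the claim is an induction. -/
theorem cfc_apply_eigenvector {A : K →L[ℂ] K} (hA : IsSelfAdjoint A) (f : ℝ → ℝ) {v : K} {x : ℝ}
    (hv : A v = (x : ℂ) • v) (hne : v ≠ 0) : cfc f A v = (f x : ℂ) • v := by
  have hx : x ∈ spectrum ℝ A := by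
    rw [← spectrum.algebraMap_mem_iff ℂ, ← AlgEquiv.spectrum_eq (Module.End.toContinuousLinearMap K).symm A]
    exact Module.End.hasEigenvalue_iff_mem_spectrum.1
      (Module.End.hasEigenvalue_of_hasEigenvector
        ⟨Module.End.mem_eigenspace_iff.2 hv, hne⟩)
  obtain ⟨q, hq⟩ : ∃ q : Polynomial ℝ, ∀ y ∈ spectrum ℝ A, q.eval y = f y :=
    ⟨Lagrange.interpolate (finite_spectrum_real A).toFinset id f, fun y hy =>
      Lagrange.eval_interpolate_at_node f Function.injective_id.injOn
        ((finite_spectrum_real A).mem_toFinset.2 hy)⟩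
  rw [cfc_congr (f := f) (g := q.eval) (fun y hy => (hq y hy).symm), cfc_polynomial q A hA,
    ← hq x hx]
  clear hq
  induction q using Polynomial.induction_on with
  | C a =>
    rw [Polynomial.aeval_C, Algebra.algebraMap_eq_smul_one, Polynomial.eval_C]
    rfl
  | add p q hp hq => 
    rw [map_add, add_apply, hp, hq, Polynomial.eval_add, Complex.ofReal_add, add_smul]
  | monomial n a h =>
    rw [pow_succ, ← mul_assoc, map_mul, Polynomial.aeval_X, mul_apply_eq_comp, hv, map_smul, h,
      smul_smul, Polynomial.eval_mul_X, Complex.ofReal_mul, mul_comm]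

/-- The functional calculus powers of a faithful positive operator are diagonal in an eigenbasis. -/
theorem exists_eigenbasis_rpow {A : K →L[ℂ] K} (hA : 0 ≤ A) (hker : ∀ ψ, A ψ = 0 → ψ = 0) :
    ∃ (e : OrthonormalBasis (Fin (Module.finrank ℂ K)) ℂ K) (l : Fin (Module.finrank ℂ K) → ℝ),
      (∀ i, 0 < l i) ∧ ∀ (s : ℝ) i, (A ^ s) (e i) = ((l i ^ s : ℝ) : ℂ) • e i := by
  have hpos := (ContinuousLinearMap.nonneg_iff_isPositive A).1 hA
  have hsym : (A : K →ₗ[ℂ] K).IsSymmetric := hpos.isSymmetric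
  have hv (i) : A (hsym.eigenvectorBasis rfl i) =
      (hsym.eigenvalues rfl i : ℂ) • hsym.eigenvectorBasis rfl i := hsym.apply_eigenvectorBasis rfl i
  have hne (i) : hsym.eigenvectorBasis rfl i ≠ 0 :=
    (hsym.eigenvectorBasis rfl).orthonormal.ne_zero i
  refine ⟨hsym.eigenvectorBasis rfl, hsym.eigenvalues rfl, fun i => ?_, fun s i => ?_⟩
  · have h0 : 0 ≤ hsym.eigenvalues rfl i :=
      eigenvalue_nonneg_of_nonneg (hsym.hasEigenvalue_eigenvalues rfl i) hpos.re_inner_nonneg_right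
    refine lt_of_le_of_ne h0 fun h => hne i (hker _ ?_)
    rw [hv, ← h, Complex.ofReal_zero, zero_smul]
  · rw [CFC.rpow_eq_cfc_real hA]
    exact cfc_apply_eigenvector hA.isSelfAdjoint _ (hv i) (hne i)

/-- A real-linear `*`-homomorphism of the operator algebra commutes with real powers. -/
theorem StarAlgHom.map_rpow_of_nonneg (φ : (K →L[ℂ] K) →⋆ₐ[ℝ] (K →L[ℂ] K)) {A : K →L[ℂ] K}
    (hA : 0 ≤ A) (s : ℝ) : φ (A ^ s) = φ A ^ s := by
  have hφA : 0 ≤ φ A := map_nonneg φ hA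
  have : FiniteDimensional ℝ (K →L[ℂ] K) := Module.Finite.trans ℂ _
  have hc : Continuous φ := φ.toAlgHom.toLinearMap.continuous_of_finiteDimensional
  rw [CFC.rpow_eq_cfc_real hA, CFC.rpow_eq_cfc_real hφA]
  exact φ.map_cfc _ A ((finite_spectrum_real A).continuousOn _) hc hA.isSelfAdjoint
    hφA.isSelfAdjoint

/-- A linear functional with the trace property is a multiple of the trace. -/
theorem opTrace_eq_of_tracial (f : (K →L[ℂ] K) →ₗ[ℂ] ℂ) (hf : ∀ A B, f (A * B) = f (B * A))
    (h1 : f 1 = opTrace (1 : K →L[ℂ] K)) (A : K →L[ℂ] K) : f A = opTrace A := by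
  let b := stdOrthonormalBasis ℂ K
  let E (i j) : K →L[ℂ] K := InnerProductSpace.rankOne ℂ (b i) (b j)
  have hE (i j) : E j i * E i j = E j j := by
    ext x
    simp [E]
  have hEA (i j) : E i j * A * E j i = inner ℂ (b j) (A (b j)) • E i i := by
    ext x
    simp [E, smul_smul, mul_comm]
  have hsum : ∑ j, E j j = 1 := by
    ext x
    simp [E, b.sum_repr']
  -- The same double sum is evaluated twice: directly through matrix units, and after cycling inside
  -- `f`. Comparing gives `tr A * f 1 = tr 1 * f A`.
  have h2 : ∑ i, ∑ j, f (E i j * A * E j i) = opTrace A * f 1 := by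
    rw [opTrace_eq_sum_inner b, ← hsum, map_sum, Finset.sum_comm, Finset.sum_mul_sum]
    simp only [hEA, map_smul, smul_eq_mul]
  have h3 : ∑ i, ∑ j, f (E i j * A * E j i) = opTrace (1 : K →L[ℂ] K) * f A := by
    have h4 (i j) : f (E i j * A * E j i) = f (A * E j j) := by
      rw [mul_assoc, hf, mul_assoc, hE]
    have h5 : ∑ j, f (A * E j j) = f A := by rw [← map_sum, ← Finset.mul_sum, hsum, mul_one]
    simp [h4, h5, opTrace]
  rw [h2, h1] at h3
  rcases eq_or_ne (opTrace (1 : K →L[ℂ] K)) 0 with h0 | h0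
  · have hK : IsEmpty (Fin (Module.finrank ℂ K)) := by
      have h5 : Module.finrank ℂ K = 0 := by simpa [opTrace] using h0
      exact h5 ▸ Fin.isEmpty
    have hA : A = 0 := by
      rw [← one_mul A, ← hsum]
      simp
    simp [hA, opTrace]
  · rw [mul_comm] at h3
    exact (mul_left_cancel₀ h0 h3).symm

/-- The trace of the image under an anti-linear automorphism is the conjugate trace. -/
theorem opTrace_map_of_antilinear (Θ : (K →L[ℂ] K) →ₛₗ[starRingEnd ℂ] (K →L[ℂ] K))
    (hmul : ∀ A B, Θ (A * B) = Θ A * Θ B) (hone : Θ 1 = 1) (A : K →L[ℂ] K) :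
    opTrace (Θ A) = starRingEnd ℂ (opTrace A) := by
  let f : (K →L[ℂ] K) →ₗ[ℂ] ℂ :=
    { toFun := fun A => starRingEnd ℂ (opTrace (Θ A))
      map_add' := fun A B => by simp [opTrace_add]
      map_smul' := fun c A => by simp [opTrace_smul] }
  have h := opTrace_eq_of_tracial f (fun A B => by simp [f, hmul, opTrace_mul_comm (Θ A)])
    (by simp [f, hone, opTrace]) A
  rw [← h]
  simp [f]

theorem eq_zero_of_opTrace_mul_eq_zero {A : K →L[ℂ] K} (h : ∀ B, opTrace (A * B) = 0) :
    A = 0 := by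
  ext x
  let b := stdOrthonormalBasis ℂ K
  -- Testing against the rank-one operator `|x⟩⟨A x|` produces `‖A x‖ ^ 2`.
  have h2 := h (InnerProductSpace.rankOne ℂ x (A x))
  have h3 : A * InnerProductSpace.rankOne ℂ x (A x) = InnerProductSpace.rankOne ℂ (A x) (A x) := by
    ext y
    simp
  rw [h3, opTrace, InnerProductSpace.trace_rankOne] at h2
  simpa using h2

/-! ### Error probabilities and the Powers–Størmer upper bound -/

theorem testError_nonneg {p : ℝ} (hp : p ∈ Set.Icc (0 : ℝ) 1) {ρ ν P : K →L[ℂ] K} (hρ : 0 ≤ ρ)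
    (hν : 0 ≤ ν) (hP : IsStarProjection P) : 0 ≤ testError p ρ ν P := by
  have h1 := (Complex.le_def.1 (opTrace_mul_nonneg hρ hP.one_sub.nonneg)).1
  have h2 := (Complex.le_def.1 (opTrace_mul_nonneg hν hP.nonneg)).1
  exact add_nonneg (mul_nonneg hp.1 h1) (mul_nonneg (sub_nonneg.2 hp.2) h2)

theorem minError_le {p : ℝ} (hp : p ∈ Set.Icc (0 : ℝ) 1) {ρ ν P : K →L[ℂ] K} (hρ : 0 ≤ ρ)
    (hν : 0 ≤ ν) (hP : IsStarProjection P) : minError p ρ ν ≤ testError p ρ ν P :=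
  ciInf_le (f := fun P : {P : K →L[ℂ] K // IsStarProjection P} => testError p ρ ν P)
    ⟨0, by rintro _ ⟨P, rfl⟩; exact testError_nonneg hp hρ hν P.2⟩ ⟨P, hP⟩

theorem le_minError {p c : ℝ} {ρ ν : K →L[ℂ] K}
    (h : ∀ P, IsStarProjection P → c ≤ testError p ρ ν P) : c ≤ minError p ρ ν :=
  have : Nonempty {P : K →L[ℂ] K // IsStarProjection P} := ⟨0, IsStarProjection.zero _⟩
  le_ciInf fun P => h P P.2

/-- A form of the Powers–Størmer inequality. -/
theorem exists_projection_trace_le {S T : K →L[ℂ] K} (hS : 0 ≤ S) (hT : 0 ≤ T) :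
    ∃ P : K →L[ℂ] K, IsStarProjection P ∧
      (opTrace (S * S * (1 - P))).re + (opTrace (T * T * P)).re ≤ (opTrace (S * T)).re := by
  have hX : IsSelfAdjoint (S - T) := hS.isSelfAdjoint.sub hT.isSelfAdjoint
  have hc (f : ℝ → ℝ) : ContinuousOn f (spectrum ℝ (S - T)) :=
    (finite_spectrum_real (S - T)).continuousOn f
  -- `P` is the spectral projection of `S - T` onto `[0, ∞)`. Both `P (S - T)` and `(T - S)(1 - P)`
  -- are positive; tracing them against `T` and `S` and adding cancels the terms `tr(S T P)`.
  let g : ℝ → ℝ := fun x => if 0 ≤ x then 1 else 0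
  have hP : IsStarProjection (cfc g (S - T)) := by
    refine ⟨?_, cfc_predicate g _⟩
    rw [IsIdempotentElem, ← cfc_mul g g _ (hc _) (hc _)]
    congr 1
    ext x
    simp [g]
  set P := cfc g (S - T) with hPdef
  have h1 : 0 ≤ P * (S - T) := by
    have : P * (S - T) = cfc (fun x => g x * x) (S - T) := by
      rw [cfc_mul g (fun x => x) _ (hc _) (hc _), cfc_id' ℝ (S - T) hX]
    rw [this]
    refine cfc_nonneg fun x _ => ?_
    by_cases h : 0 ≤ x <;> simp [g, h]
  have h2 : 0 ≤ (T - S) * (1 - P) := by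
    have : (T - S) * (1 - P) = cfc (fun x => (-x) * (1 - g x)) (S - T) := by
      rw [cfc_mul (fun x => -x) (fun x => 1 - g x) _ (hc _) (hc _), cfc_neg, cfc_id' ℝ (S - T) hX,
        cfc_sub (fun _ => 1) g _ (hc _) (hc _), cfc_const_one ℝ (S - T) hX, neg_sub]
    rw [this]
    refine cfc_nonneg fun x _ => ?_
    by_cases h : 0 ≤ x
    · simp [g, h]
    · simpa [g, h] using (not_le.1 h).le
  refine ⟨P, hP, ?_⟩
  have h3 := (Complex.le_def.1 (opTrace_mul_nonneg hT h1)).1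
  have h4 := (Complex.le_def.1 (opTrace_mul_nonneg hS h2)).1
  have e1 : opTrace (S * ((T - S) * (1 - P))) =
      opTrace (S * T) - opTrace (S * T * P) - opTrace (S * S * (1 - P)) := by
    rw [← opTrace_sub, ← opTrace_sub]
    congr 1
    noncomm_ring
  have e2 : opTrace (T * (P * (S - T))) = opTrace (S * T * P) - opTrace (T * T * P) := by
    rw [← mul_assoc, opTrace_mul_comm, sub_mul, opTrace_sub, mul_assoc, mul_assoc]
  rw [e1] at h4
  rw [e2] at h3
  simp only [Complex.sub_re, Complex.zero_re] at h3 h4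
  linarith

/-- The quasi-entropy `tr (ρ^α ν^(1-α))`. -/
def quasiEntropy (ρ ν : K →L[ℂ] K) (α : ℝ) : ℝ := (opTrace (ρ ^ α * ν ^ (1 - α))).re

theorem quasiEntropy_nonneg (ρ ν : K →L[ℂ] K) (α : ℝ) : 0 ≤ quasiEntropy ρ ν α := by
  have h : 0 ≤ opTrace (ρ ^ α * ν ^ (1 - α)) :=
    opTrace_mul_nonneg CFC.rpow_nonneg CFC.rpow_nonneg
  exact (Complex.le_def.1 h).1

theorem re_opTrace_real_smul (c : ℝ) (A : K →L[ℂ] K) :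
    (opTrace (c • A)).re = c * (opTrace A).re := by
  have : c • A = (c : ℂ) • A := rfl
  rw [this, opTrace_smul, Complex.re_ofReal_mul]

theorem sqrt_smul_rpow_half_mul_self {A : K →L[ℂ] K} (hA : 0 ≤ A) {c : ℝ} (hc : 0 ≤ c) :
    (√c • A ^ (1 / 2 : ℝ)) * (√c • A ^ (1 / 2 : ℝ)) = c • A := by
  rw [← CFC.sqrt_eq_rpow, smul_mul_smul_comm, CFC.sqrt_mul_sqrt_self A hA, Real.mul_self_sqrt hc]

/-- Powers–Størmer applies to `S = √p ρ^(1/2)` and `T = √(1-p) ν^(1/2)`, and the resulting prefactor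
`√p √(1-p)` is at most `1`. -/
theorem minError_le_quasiEntropy {p : ℝ} (hp : p ∈ Set.Icc (0 : ℝ) 1) {ρ ν : K →L[ℂ] K}
    (hρ : 0 ≤ ρ) (hν : 0 ≤ ν) : minError p ρ ν ≤ quasiEntropy ρ ν (1 / 2) := by
  have hp' : 0 ≤ 1 - p := sub_nonneg.2 hp.2
  have hS : 0 ≤ √p • ρ ^ (1 / 2 : ℝ) := smul_nonneg (Real.sqrt_nonneg p) CFC.rpow_nonneg
  have hT : 0 ≤ √(1 - p) • ν ^ (1 / 2 : ℝ) :=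
    smul_nonneg (Real.sqrt_nonneg (1 - p)) CFC.rpow_nonneg
  obtain ⟨P, hP, h⟩ := exists_projection_trace_le hS hT
  refine (minError_le hp hρ hν hP).trans ?_
  rw [testError]
  rw [sqrt_smul_rpow_half_mul_self hρ hp.1, sqrt_smul_rpow_half_mul_self hν hp',
    smul_mul_assoc, smul_mul_assoc, smul_mul_smul_comm, re_opTrace_real_smul,
    re_opTrace_real_smul, re_opTrace_real_smul] at h
  refine h.trans ?_
  have h0 : 0 ≤ quasiEntropy ρ ν (1 / 2) := quasiEntropy_nonneg ρ ν _
  have h1 : √p * √(1 - p) ≤ 1 :=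
    mul_le_one₀ (Real.sqrt_le_one.2 hp.2) (Real.sqrt_nonneg _)
      (Real.sqrt_le_one.2 (by linarith [hp.1]))
  have h2 : (1 : ℝ) - 1 / 2 = 1 / 2 := by norm_num
  rw [quasiEntropy, h2] at h0 ⊢
  exact mul_le_of_le_one_left h0 h1

/-! ### Nussbaum–Szkoła lower bound and joint eigenbasis sums -/

theorem re_opTrace_mul_projection {ι κ : Type*} [Fintype ι] [Fintype κ]
    (e : OrthonormalBasis ι ℂ K) (f : OrthonormalBasis κ ℂ K) {A : K →L[ℂ] K} {l : ι → ℝ}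
    (hA : ∀ i, A (e i) = (l i : ℂ) • e i) {R : K →L[ℂ] K} (hR : IsStarProjection R) :
    (opTrace (A * R)).re = ∑ i, ∑ j, l i * ‖inner ℂ (f j) (R (e i))‖ ^ 2 := by
  rw [opTrace_mul_comm, opTrace_eq_sum_inner e, Complex.re_sum]
  refine Finset.sum_congr rfl fun i _ => ?_
  rw [← Finset.mul_sum, f.sum_sq_norm_inner_right, mul_apply_eq_comp, hA, map_smul,
    inner_smul_right, Complex.re_ofReal_mul]
  congr 1
  have h := ContinuousLinearMap.adjoint_inner_left R (R (e i)) (e i)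
  rw [← ContinuousLinearMap.star_eq_adjoint, hR.isSelfAdjoint.star_eq, ← mul_apply_eq_comp,
    hR.isIdempotentElem.eq] at h
  rw [← h]
  exact inner_self_eq_norm_sq (𝕜 := ℂ) _

/-- Both error terms become sums over the same pairs `(i, j)`. The overlap of `e i` and `f j` splits
along `1 - P` and `P`, and `(y + z)² ≤ 2 (y² + z²)` costs the factor `1/2`. -/
theorem min_mul_sum_le_testError {ι κ : Type*} [Fintype ι] [Fintype κ]
    (e : OrthonormalBasis ι ℂ K) (f : OrthonormalBasis κ ℂ K) {ρ ν : K →L[ℂ] K} {l : ι → ℝ}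
    {m : κ → ℝ} (hl : ∀ i, 0 ≤ l i) (hm : ∀ j, 0 ≤ m j) (hρ : ∀ i, ρ (e i) = (l i : ℂ) • e i)
    (hν : ∀ j, ν (f j) = (m j : ℂ) • f j) {p : ℝ} (hp : p ∈ Set.Icc (0 : ℝ) 1) {P : K →L[ℂ] K}
    (hP : IsStarProjection P) :
    min p (1 - p) / 2 * ∑ j, ∑ i, ‖inner ℂ (e i) (f j)‖ ^ 2 * min (l i) (m j) ≤
      testError p ρ ν P := by
  have h0 := re_opTrace_mul_projection e f hρ hP.one_sub
  rw [Finset.sum_comm] at h0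
  rw [testError, h0, re_opTrace_mul_projection f e hν hP, Finset.mul_sum, Finset.mul_sum,
    Finset.mul_sum, ← Finset.sum_add_distrib]
  refine Finset.sum_le_sum fun j _ => ?_
  rw [Finset.mul_sum, Finset.mul_sum, Finset.mul_sum, ← Finset.sum_add_distrib]
  refine Finset.sum_le_sum fun i _ => ?_
  have h1 : ‖inner ℂ (f j) ((1 - P) (e i))‖ = ‖inner ℂ (e i) ((1 - P) (f j))‖ := by
    have h := ContinuousLinearMap.adjoint_inner_left (1 - P) (e i) (f j)
    rw [← ContinuousLinearMap.star_eq_adjoint, hP.one_sub.isSelfAdjoint.star_eq] at h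
    rw [← h, ← inner_conj_symm, RCLike.norm_conj]
  have h2 : ‖inner ℂ (e i) (f j)‖ ≤
      ‖inner ℂ (f j) ((1 - P) (e i))‖ + ‖inner ℂ (e i) (P (f j))‖ := by
    rw [h1]
    refine le_trans (le_of_eq ?_) (norm_add_le _ _)
    rw [← inner_add_right]
    simp
  set x := ‖inner ℂ (e i) (f j)‖
  set y := ‖inner ℂ (f j) ((1 - P) (e i))‖
  set z := ‖inner ℂ (e i) (P (f j))‖
  have hx : x ^ 2 ≤ 2 * (y ^ 2 + z ^ 2) := by
    have : x ^ 2 ≤ (y + z) ^ 2 := pow_le_pow_left₀ (norm_nonneg _) h2 2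
    nlinarith [sq_nonneg (y - z)]
  have hlm : 0 ≤ min (l i) (m j) := le_min (hl i) (hm j)
  have hpp : 0 ≤ min p (1 - p) := le_min hp.1 (sub_nonneg.2 hp.2)
  have h3 : min p (1 - p) * min (l i) (m j) ≤ p * l i :=
    mul_le_mul (min_le_left _ _) (min_le_left _ _) hlm hp.1
  have h4 : min p (1 - p) * min (l i) (m j) ≤ (1 - p) * m j :=
    mul_le_mul (min_le_right _ _) (min_le_right _ _) hlm (sub_nonneg.2 hp.2)
  have h5 := mul_le_mul_of_nonneg_right h3 (sq_nonneg y)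
  have h6 := mul_le_mul_of_nonneg_right h4 (sq_nonneg z)
  have h7 := mul_le_mul_of_nonneg_left hx (mul_nonneg hpp hlm)
  linarith

/-- If `|log x - log y| ≤ c`, then `e^{-c/2} √(xy) ≤ min x y`. Otherwise one of the tilted terms
`e^{-sc} √(xy) (x/y)^{±s}` is at least `√(xy)`, and the left side is nonpositive: a Chebyshev bound
in pointwise form. -/
theorem exp_mul_rpow_le_min {x y c s : ℝ} (hx : 0 < x) (hy : 0 < y) (hs : 0 ≤ s) :
    Real.exp (-c / 2) * (x ^ (1 / 2 : ℝ) * y ^ (1 - 1 / 2 : ℝ) - Real.exp (-(s * c)) *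
      (x ^ (1 / 2 + s) * y ^ (1 - (1 / 2 + s)) + x ^ (1 / 2 - s) * y ^ (1 - (1 / 2 - s)))) ≤
      min x y := by
  obtain ⟨a, rfl⟩ : ∃ a, Real.exp a = x := ⟨_, Real.exp_log hx⟩
  obtain ⟨b, rfl⟩ : ∃ b, Real.exp b = y := ⟨_, Real.exp_log hy⟩
  simp only [← Real.exp_mul, ← Real.exp_add, mul_add, mul_sub]
  rcases le_or_gt |a - b| c with h | h
  · obtain ⟨h1, h2⟩ := abs_le.1 h
    have h3 : Real.exp (-c / 2 + (a * (1 / 2) + (b * 1 - b * (1 / 2)))) ≤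
        min (Real.exp a) (Real.exp b) :=
      le_min (Real.exp_le_exp.2 (by linarith)) (Real.exp_le_exp.2 (by linarith))
    refine le_trans (sub_le_self _ (by positivity)) h3
  · refine le_trans (sub_nonpos.2 ?_) (le_min (Real.exp_pos _).le (Real.exp_pos _).le)
    rcases lt_abs.1 h with h | h
    · exact le_add_of_le_of_nonneg (Real.exp_le_exp.2 (by nlinarith)) (Real.exp_pos _).le
    · exact le_add_of_nonneg_of_le (Real.exp_pos _).le (Real.exp_le_exp.2 (by nlinarith))

/-- The trace functional `tr (ρ^α ν^(1-α))` as a sum over the joint eigenbases, together with the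
Nussbaum–Szkoła lower bound on the error probability. -/
theorem exists_quasiEntropy_eq_sum {ρ ν : K →L[ℂ] K} (hρ : 0 ≤ ρ) (hν : 0 ≤ ν)
    (hρ0 : ∀ ψ, ρ ψ = 0 → ψ = 0) (hν0 : ∀ ψ, ν ψ = 0 → ψ = 0) :
    ∃ (e f : OrthonormalBasis (Fin (Module.finrank ℂ K)) ℂ K)
      (l m : Fin (Module.finrank ℂ K) → ℝ), (∀ i, 0 < l i) ∧ (∀ j, 0 < m j) ∧
      (∀ i, ρ (e i) = (l i : ℂ) • e i) ∧ (∀ j, ν (f j) = (m j : ℂ) • f j) ∧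
      ∀ α, quasiEntropy ρ ν α =
        ∑ j, ∑ i, ‖inner ℂ (e i) (f j)‖ ^ 2 * (l i ^ α * m j ^ (1 - α)) := by
  obtain ⟨e, l, hl, he⟩ := exists_eigenbasis_rpow hρ hρ0
  obtain ⟨f, m, hm, hf⟩ := exists_eigenbasis_rpow hν hν0
  refine ⟨e, f, l, m, hl, hm, fun i => ?_, fun j => ?_, fun α => ?_⟩
  · simpa [CFC.rpow_one ρ hρ] using he 1 i
  · simpa [CFC.rpow_one ν hν] using hf 1 j
  · exact opTrace_mul_eq_sum e f CFC.rpow_nonneg.isSelfAdjoint (he α) (hf (1 - α))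

/-- Strict positivity makes the logarithm in the pressure genuine, excluding the default `Real.log 0
= 0`. If the sum vanished, some unit vector `f j₀` would be orthogonal to the whole basis `e`. -/
theorem quasiEntropy_pos [Nontrivial K] {ρ ν : K →L[ℂ] K} (hρ : 0 ≤ ρ) (hν : 0 ≤ ν)
    (hρ0 : ∀ ψ, ρ ψ = 0 → ψ = 0) (hν0 : ∀ ψ, ν ψ = 0 → ψ = 0) (α : ℝ) :
    0 < quasiEntropy ρ ν α := by
  obtain ⟨e, f, l, m, hl, hm, -, -, h⟩ := exists_quasiEntropy_eq_sum hρ hν hρ0 hν0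
  rw [h]
  have hlm (i j) : 0 < l i ^ α * m j ^ (1 - α) :=
    mul_pos (Real.rpow_pos_of_pos (hl i) _) (Real.rpow_pos_of_pos (hm j) _)
  have hn (j) : 0 ≤ ∑ i, ‖inner ℂ (e i) (f j)‖ ^ 2 * (l i ^ α * m j ^ (1 - α)) :=
    Finset.sum_nonneg fun i _ => mul_nonneg (sq_nonneg _) (hlm i j).le
  let j₀ : Fin (Module.finrank ℂ K) := ⟨0, Module.finrank_pos⟩
  refine Finset.sum_pos' (fun j _ => hn j) ⟨j₀, Finset.mem_univ _, lt_of_le_of_ne (hn j₀) fun h0 => ?_⟩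
  have h1 := (Finset.sum_eq_zero_iff_of_nonneg
    fun i _ => mul_nonneg (sq_nonneg _) (hlm i j₀).le).1 h0.symm
  have h2 := e.sum_sq_norm_inner_right (f j₀)
  rw [Finset.sum_eq_zero fun i hi => (mul_eq_zero.1 (h1 i hi)).resolve_right (hlm i j₀).ne'] at h2
  simp at h2

/-- Cauchy–Schwarz over pairs: the summands at `α` and `1 - α` multiply to the square of the summand
at `1/2`. -/
theorem sq_quasiEntropy_half_le {ρ ν : K →L[ℂ] K} (hρ : 0 ≤ ρ) (hν : 0 ≤ ν)
    (hρ0 : ∀ ψ, ρ ψ = 0 → ψ = 0) (hν0 : ∀ ψ, ν ψ = 0 → ψ = 0) (α : ℝ) :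
    quasiEntropy ρ ν (1 / 2) ^ 2 ≤ quasiEntropy ρ ν α * quasiEntropy ρ ν (1 - α) := by
  obtain ⟨e, f, l, m, hl, hm, -, -, h⟩ := exists_quasiEntropy_eq_sum hρ hν hρ0 hν0
  simp only [h, ← Fintype.sum_prod_type']
  have hlm (a : ℝ) (q : Fin (Module.finrank ℂ K) × Fin (Module.finrank ℂ K)) :
      0 ≤ ‖inner ℂ (e q.2) (f q.1)‖ ^ 2 * (l q.2 ^ a * m q.1 ^ (1 - a)) :=
    mul_nonneg (sq_nonneg _) (mul_nonneg (Real.rpow_nonneg (hl _).le _)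
      (Real.rpow_nonneg (hm _).le _))
  refine Finset.sum_sq_le_sum_mul_sum_of_sq_le_mul _ (fun q _ => hlm α q)
    (fun q _ => hlm (1 - α) q) fun q _ => le_of_eq ?_
  have hr {x : ℝ} (hx : 0 < x) (a b : ℝ) (hab : a + b = 1) : x ^ a * x ^ b = x := by
    rw [← Real.rpow_add hx, hab, Real.rpow_one]
  have h1 := hr (hl q.2) (1 / 2) (1 / 2) (by norm_num)
  have h2 := hr (hm q.1) (1 - 1 / 2) (1 - 1 / 2) (by norm_num)
  have h3 := hr (hl q.2) α (1 - α) (by ring)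
  have h4 := hr (hm q.1) (1 - α) (1 - (1 - α)) (by ring)
  calc _ = (‖inner ℂ (e q.2) (f q.1)‖ ^ 2) ^ 2 *
        ((l q.2 ^ (1 / 2 : ℝ) * l q.2 ^ (1 / 2 : ℝ)) *
          (m q.1 ^ (1 - 1 / 2 : ℝ) * m q.1 ^ (1 - 1 / 2 : ℝ))) := by ring
    _ = (‖inner ℂ (e q.2) (f q.1)‖ ^ 2) ^ 2 * ((l q.2 ^ α * l q.2 ^ (1 - α)) *
          (m q.1 ^ (1 - α) * m q.1 ^ (1 - (1 - α)))) := by rw [h1, h2, h3, h4]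
    _ = _ := by ring

theorem le_minError_of_quasiEntropy {p : ℝ} (hp : p ∈ Set.Icc (0 : ℝ) 1) {ρ ν : K →L[ℂ] K}
    (hρ : 0 ≤ ρ) (hν : 0 ≤ ν) (hρ0 : ∀ ψ, ρ ψ = 0 → ψ = 0) (hν0 : ∀ ψ, ν ψ = 0 → ψ = 0)
    {c s : ℝ} (hs : 0 ≤ s) :
    min p (1 - p) / 2 * (Real.exp (-c / 2) * (quasiEntropy ρ ν (1 / 2) - Real.exp (-(s * c)) *
      (quasiEntropy ρ ν (1 / 2 + s) + quasiEntropy ρ ν (1 / 2 - s)))) ≤ minError p ρ ν := by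
  obtain ⟨e, f, l, m, hl, hm, he, hf, h⟩ := exists_quasiEntropy_eq_sum hρ hν hρ0 hν0
  refine le_minError fun P hP => le_trans ?_
    (min_mul_sum_le_testError e f (fun i => (hl i).le) (fun j => (hm j).le) he hf hp hP)
  refine mul_le_mul_of_nonneg_left ?_ (by linarith [le_min hp.1 (sub_nonneg.2 hp.2)])
  simp only [h, ← Fintype.sum_prod_type', ← Finset.sum_add_distrib, Finset.mul_sum,
    ← Finset.sum_sub_distrib]
  refine Finset.sum_le_sum fun q _ => ?_
  have := mul_le_mul_of_nonneg_left (exp_mul_rpow_le_min (c := c) (hl q.2) (hm q.1) hs)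
    (sq_nonneg ‖inner ℂ (e q.2) (f q.1)‖)
  refine le_trans (le_of_eq ?_) this
  ring

/-! ### Dynamics and time reversal of finite systems -/

theorem isUnit_of_faithful {A : K →L[ℂ] K} (h : ∀ ψ, A ψ = 0 → ψ = 0) : IsUnit A := by
  have hinj : Function.Injective (A : K →ₗ[ℂ] K) := (injective_iff_map_eq_zero _).2 h
  exact ContinuousLinearMap.isUnit_iff_bijective.2 ⟨hinj, LinearMap.injective_iff_surjective.1 hinj⟩

/-- The real-linear `*`-homomorphism underlying an anti-linear one. -/
def realStarAlgHomOfAntilinear (Θ : (K →L[ℂ] K) →ₛₗ[starRingEnd ℂ] (K →L[ℂ] K))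
    (hmul : ∀ A B, Θ (A * B) = Θ A * Θ B) (hone : Θ 1 = 1) (hstar : ∀ A, Θ (star A) = star (Θ A)) :
    (K →L[ℂ] K) →⋆ₐ[ℝ] (K →L[ℂ] K) where
  toFun := Θ
  map_one' := hone
  map_mul' := hmul
  map_zero' := map_zero Θ
  map_add' := map_add Θ
  commutes' r := by
    have h : algebraMap ℝ (K →L[ℂ] K) r = (r : ℂ) • 1 := Algebra.algebraMap_eq_smul_one r
    rw [h, map_smulₛₗ, hone, Complex.conj_ofReal]
  map_star' := hstar

namespace FiniteQuantumSystem

variable (Q : FiniteQuantumSystem K)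

theorem nontrivial (Q : FiniteQuantumSystem K) : Nontrivial K := by
  by_contra h
  rw [not_nontrivial_iff_subsingleton] at h
  have h1 := Q.trace_state
  rw [Subsingleton.elim (Q.state : K →ₗ[ℂ] K) 0, map_zero] at h1
  exact zero_ne_one h1

/-- The unitary propagator `e^{itH}`. -/
def propagator (t : ℝ) : unitary (K →L[ℂ] K) :=
  selfAdjoint.expUnitary ⟨(t : ℂ) • Q.hamiltonian, by
    rw [selfAdjoint.mem_iff, star_smul, Q.isSelfAdjoint_hamiltonian.star_eq]
    simp⟩

theorem evolve_eq_conj (t : ℝ) (A : K →L[ℂ] K) :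
    Q.evolve t A = Unitary.conjStarAlgAut ℂ _ (Q.propagator t) A := by
  rw [Unitary.conjStarAlgAut_apply, propagator, selfAdjoint.expUnitary_coe, NormedSpace.star_exp,
    evolve]
  simp [mul_smul, Q.isSelfAdjoint_hamiltonian.star_eq]

theorem evolve_zero (A : K →L[ℂ] K) : Q.evolve 0 A = A := by
  simp [evolve]

theorem evolve_evolve (s t : ℝ) (A : K →L[ℂ] K) : Q.evolve s (Q.evolve t A) = Q.evolve (s + t) A := by
  have h (a b : ℂ) : NormedSpace.exp (a • Q.hamiltonian) * NormedSpace.exp (b • Q.hamiltonian) =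
      NormedSpace.exp ((a + b) • Q.hamiltonian) := by
    let _ : NormedAlgebra ℚ (K →L[ℂ] K) := NormedAlgebra.restrictScalars ℚ ℂ _
    rw [add_smul, NormedSpace.exp_add_of_commute]
    exact ((Commute.refl Q.hamiltonian).smul_left a).smul_right b
  simp only [evolve]
  rw [Complex.ofReal_add, mul_add, ← h, neg_add_rev, ← h]
  simp only [mul_assoc]

theorem evolve_mul (t : ℝ) (A B : K →L[ℂ] K) :
    Q.evolve t (A * B) = Q.evolve t A * Q.evolve t B := by
  simp only [evolve_eq_conj, map_mul]

theorem evolve_rpow (t : ℝ) {A : K →L[ℂ] K} (hA : 0 ≤ A) (s : ℝ) :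
    Q.evolve t (A ^ s) = Q.evolve t A ^ s := by
  simp only [evolve_eq_conj]
  exact StarAlgHom.map_rpow_of_nonneg
    (((Unitary.conjStarAlgAut ℂ _ (Q.propagator t)) :
      (K →L[ℂ] K) →⋆ₐ[ℂ] (K →L[ℂ] K)).restrictScalars ℝ) hA s

theorem opTrace_evolve (t : ℝ) (A : K →L[ℂ] K) : opTrace (Q.evolve t A) = opTrace A := by
  rw [evolve_eq_conj, Unitary.conjStarAlgAut_apply, opTrace_mul_comm, ← mul_assoc,
    Unitary.coe_star_mul_self, one_mul]

theorem stateAt_nonneg (t : ℝ) : 0 ≤ Q.stateAt t := by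
  rw [stateAt, evolve_eq_conj]
  exact map_nonneg _ Q.state_nonneg

theorem stateAt_zero : Q.stateAt 0 = Q.state := by
  rw [stateAt, neg_zero, evolve_zero]

theorem evolve_stateAt (s t : ℝ) : Q.evolve s (Q.stateAt t) = Q.stateAt (t - s) := by
  rw [stateAt, stateAt, evolve_evolve]
  congr 1
  ring

theorem stateAt_faithful (t : ℝ) (ψ : K) (h : Q.stateAt t ψ = 0) : ψ = 0 := by
  have hu : IsUnit (Q.stateAt t) := by
    rw [stateAt, evolve_eq_conj]
    exact (isUnit_of_faithful Q.faithful).map _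
  exact (ContinuousLinearMap.isUnit_iff_bijective.1 hu).1 (h.trans (map_zero _).symm)

theorem quasiEntropy_stateAt_sub (s t r α : ℝ) :
    quasiEntropy (Q.stateAt (s - r)) (Q.stateAt (t - r)) α =
      quasiEntropy (Q.stateAt s) (Q.stateAt t) α := by
  simp only [quasiEntropy, ← evolve_stateAt]
  rw [← evolve_rpow _ _ (Q.stateAt_nonneg s), ← evolve_rpow _ _ (Q.stateAt_nonneg t), ← evolve_mul,
    opTrace_evolve]

theorem exp_entropicPressure_two (t α : ℝ) :
    Real.exp (Q.entropicPressure 2 t α) = quasiEntropy (Q.stateAt t) Q.state α := by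
  have : Nontrivial K := Q.nontrivial
  have h0 : 0 ≤ Q.state ^ ((1 - α) / 2) * Q.stateAt t ^ α * Q.state ^ ((1 - α) / 2) :=
    CFC.rpow_nonneg.isSelfAdjoint.conjugate_nonneg CFC.rpow_nonneg
  have h1 : Q.entropicPressure 2 t α = Real.log (quasiEntropy (Q.stateAt t) Q.state α) := by
    rw [entropicPressure, mul_div_cancel_left₀ α (two_ne_zero' ℝ), div_self (two_ne_zero' ℝ),
      CFC.rpow_one _ h0, opTrace_mul_comm, ← mul_assoc,
      ← CFC.rpow_add (isUnit_of_faithful Q.faithful), add_halves, opTrace_mul_comm, quasiEntropy]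
  rw [h1, Real.exp_log (quasiEntropy_pos (Q.stateAt_nonneg t) Q.state_nonneg
    (Q.stateAt_faithful t) Q.faithful α)]

theorem exp_entropicPressure_two_eq_symm (t α : ℝ) :
    Real.exp (Q.entropicPressure 2 t α) =
      quasiEntropy (Q.stateAt (t / 2)) (Q.stateAt (-t / 2)) α := by
  rw [exp_entropicPressure_two, ← Q.stateAt_zero, ← Q.quasiEntropy_stateAt_sub t 0 (t / 2)]
  congr 2 <;> ring

variable {Q}

/-- `Θ` fixes the density matrix `ω`, sends `ω_t` to `ω_{-t}` and conjugates traces, so `t` may be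
replaced by `-t`. Shifting both times by `t` and cycling the trace then exchanges the two states,
that is, `α` and `1 - α`. -/
theorem IsTRI.entropicPressure_two_one_sub (hQ : Q.IsTRI) (t α : ℝ) :
    Q.entropicPressure 2 t (1 - α) = Q.entropicPressure 2 t α := by
  obtain ⟨Θ, hmul, hstar, hinv, hdyn, hst⟩ := hQ
  -- Unitality follows from multiplicativity and involutivity.
  have hone : Θ 1 = 1 := by
    have h := hmul 1 (Θ 1)
    rwa [one_mul, hinv, mul_one, eq_comm] at h
  have hω : Θ Q.state = Q.state := by
    rw [← sub_eq_zero]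
    refine eq_zero_of_opTrace_mul_eq_zero fun A => ?_
    rw [sub_mul, opTrace_sub, sub_eq_zero]
    have h1 := hst A
    have h2 := opTrace_map_of_antilinear Θ hmul hone (Θ Q.state * A)
    rw [hmul, hinv] at h2
    have h3 := opTrace_star (Q.state * A)
    rw [star_mul, Q.state_nonneg.isSelfAdjoint.star_eq, opTrace_mul_comm] at h3
    rw [expectation, expectation, h2, h3] at h1
    exact (starRingEnd ℂ).injective h1
  have hpow {A : K →L[ℂ] K} (hA : 0 ≤ A) (s : ℝ) : Θ (A ^ s) = Θ A ^ s :=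
    StarAlgHom.map_rpow_of_nonneg (realStarAlgHomOfAntilinear Θ hmul hone hstar) hA s
  have hωt : Θ (Q.stateAt t) = Q.stateAt (-t) := by
    rw [stateAt, ← hdyn, hω, stateAt, neg_neg]
  have hsymm : quasiEntropy (Q.stateAt t) Q.state α = quasiEntropy (Q.stateAt (-t)) Q.state α := by
    have h := opTrace_map_of_antilinear Θ hmul hone (Q.stateAt t ^ α * Q.state ^ (1 - α))
    rw [hmul, hpow (Q.stateAt_nonneg t), hpow Q.state_nonneg, hωt, hω] at h
    rw [quasiEntropy, quasiEntropy, h, Complex.conj_re]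
  apply Real.exp_injective
  rw [exp_entropicPressure_two, exp_entropicPressure_two, hsymm, ← Q.stateAt_zero,
    ← Q.quasiEntropy_stateAt_sub (-t) 0 (-t), sub_self, zero_sub, neg_neg, quasiEntropy, quasiEntropy,
    opTrace_mul_comm, sub_sub_cancel]

theorem IsTRI.entropicPressure_two_half_le (hQ : Q.IsTRI) (t α : ℝ) :
    Q.entropicPressure 2 t (1 / 2) ≤ Q.entropicPressure 2 t α := by
  have h := sq_quasiEntropy_half_le (Q.stateAt_nonneg t) Q.state_nonneg (Q.stateAt_faithful t)
    Q.faithful α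
  simp only [← exp_entropicPressure_two, hQ.entropicPressure_two_one_sub, ← sq] at h
  exact Real.exp_le_exp.1 (le_of_sq_le_sq h (Real.exp_pos _).le)

variable (Q)

theorem arrowError_le {p : ℝ} (hp : p ∈ Set.Icc (0 : ℝ) 1) (t : ℝ) :
    Q.arrowError p t ≤ Real.exp (Q.entropicPressure 2 t (1 / 2)) := by
  rw [exp_entropicPressure_two_eq_symm]
  exact minError_le_quasiEntropy hp (Q.stateAt_nonneg _) (Q.stateAt_nonneg _)

theorem arrowError_nonneg {p : ℝ} (hp : p ∈ Set.Icc (0 : ℝ) 1) (t : ℝ) : 0 ≤ Q.arrowError p t :=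
  le_minError fun _ hP => testError_nonneg hp (Q.stateAt_nonneg _) (Q.stateAt_nonneg _) hP

variable {Q}

theorem IsTRI.le_arrowError (hQ : Q.IsTRI) {p : ℝ} (hp : p ∈ Set.Icc (0 : ℝ) 1) (t : ℝ) {s : ℝ}
    (hs : 0 ≤ s) (c : ℝ) :
    min p (1 - p) / 2 * (Real.exp (-c / 2) * (Real.exp (Q.entropicPressure 2 t (1 / 2)) -
      Real.exp (-(s * c)) * (2 * Real.exp (Q.entropicPressure 2 t (1 / 2 + s))))) ≤
      Q.arrowError p t := by
  have h : (1 : ℝ) / 2 - s = 1 - (1 / 2 + s) := by ring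
  have h1 := le_minError_of_quasiEntropy hp (Q.stateAt_nonneg (t / 2)) (Q.stateAt_nonneg (-t / 2))
    (Q.stateAt_faithful _) (Q.stateAt_faithful _) (c := c) hs
  simp only [← exp_entropicPressure_two_eq_symm] at h1
  rwa [h, hQ.entropicPressure_two_one_sub, ← two_mul] at h1

end FiniteQuantumSystem

end FiniteDimensional

end

/-! ### Large-time asymptotics and the Chernoff exponents -/

theorem one_div_mul_log_ofReal {t x : ℝ} (hx : 0 < x) :
    ((1 / t : ℝ) : EReal) * ENNReal.log (ENNReal.ofReal x) = ((1 / t * Real.log x : ℝ) : EReal) := by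
  rw [ENNReal.log_ofReal_of_pos hx, EReal.coe_mul]

theorem one_div_mul_log_ofReal_mono {t x y : ℝ} (ht : 0 < t) (h : x ≤ y) :
    ((1 / t : ℝ) : EReal) * ENNReal.log (ENNReal.ofReal x) ≤
      ((1 / t : ℝ) : EReal) * ENNReal.log (ENNReal.ofReal y) :=
  mul_le_mul_of_nonneg_left (ENNReal.log_monotone (ENNReal.ofReal_le_ofReal h))
    (EReal.coe_nonneg.2 (by positivity))

/-- Near an interior minimum, a differentiable function increases at most with arbitrarily small
slope. -/
theorem exists_le_add_mul_of_isLocalMin {f : ℝ → ℝ} {a : ℝ} {I : Set ℝ} (hI : I ∈ 𝓝 a)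
    (hf : DifferentiableAt ℝ f a) (hmin : IsLocalMin f a) {ε : ℝ} (hε : 0 < ε) :
    ∃ s, 0 < s ∧ a + s ∈ I ∧ f (a + s) ≤ f a + s * ε := by
  have hd : HasDerivAt f 0 a := hmin.deriv_eq_zero ▸ hf.hasDerivAt
  have h1 := (hasDerivAt_iff_isLittleO_nhds_zero.1 hd).def hε
  have h2 : ∀ᶠ s in 𝓝 (0 : ℝ), a + s ∈ I :=
    (continuous_const_add a).continuousAt.preimage_mem_nhds (by rwa [add_zero])
  obtain ⟨s, ⟨h3, h4⟩, hs⟩ := (((h1.and h2).filter_mono nhdsWithin_le_nhds).and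
    (self_mem_nhdsWithin : Set.Ioi (0 : ℝ) ∈ 𝓝[>] 0)).exists
  refine ⟨s, hs, h4, ?_⟩
  rw [smul_zero, sub_zero, Real.norm_eq_abs, Real.norm_of_nonneg (le_of_lt hs)] at h3
  linarith [le_abs_self (f (a + s) - f a)]

/-- The exponential rate of the lower bound for the error probability. -/
theorem eventually_exp_le_of_lower_bound {k δ s m b : ℝ} (hk : 0 < k) (hδ : 0 < δ) (hs : 0 < s)
    {u v : ℝ → ℝ} (hu : Tendsto (fun t => 1 / t * u t) atTop (𝓝 m))
    (hv : Tendsto (fun t => 1 / t * v t) atTop (𝓝 b)) (hb : b ≤ m + s * (δ / 4)) :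
    ∀ᶠ t in atTop, Real.exp (t * (m - δ)) ≤ k * (Real.exp (-(δ * t) / 2) * (Real.exp (u t) -
      Real.exp (-(s * (δ * t))) * (2 * Real.exp (v t)))) := by
  -- `η ≤ s * δ / 8` makes the tilted term at most half of `exp (u t)` for large `t`; `η ≤ δ / 8`
  -- leaves a spare factor `exp (t * δ / 4)` to absorb `2 / k`.
  have hη : 0 < min (s * δ / 8) (δ / 8) := by positivity
  set η := min (s * δ / 8) (δ / 8) with hηdef
  have hη1 : η ≤ s * δ / 8 := min_le_left _ _
  have hη2 : η ≤ δ / 8 := min_le_right _ _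
  have hexp {r : ℝ} (hr : 0 < r) : Tendsto (fun t => Real.exp (t * r)) atTop atTop :=
    Real.tendsto_exp_atTop.comp (tendsto_id.atTop_mul_const hr)
  filter_upwards [eventually_gt_atTop 0, hu.eventually_const_le (sub_lt_self m hη),
    hv.eventually_le_const (lt_add_of_pos_right b hη),
    (hexp (by positivity : 0 < s * δ / 2)).eventually_ge_atTop 4,
    (hexp (by positivity : 0 < δ / 4)).eventually_ge_atTop (2 / k)] with t ht h1 h2 h3 h4
  rw [one_div, ← div_eq_inv_mul, le_div_iff₀ ht] at h1
  rw [one_div, ← div_eq_inv_mul, div_le_iff₀ ht] at h2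
  have h5 : 4 * (Real.exp (-(s * (δ * t))) * Real.exp (v t)) ≤ Real.exp (u t) := by
    calc _ ≤ Real.exp (t * (s * δ / 2)) * (Real.exp (-(s * (δ * t))) * Real.exp (v t)) := by gcongr
      _ = Real.exp (t * (s * δ / 2) + (-(s * (δ * t)) + v t)) := by rw [Real.exp_add, Real.exp_add]
      _ ≤ _ := Real.exp_le_exp.2 (by nlinarith)
  have h6 : Real.exp (t * (m - δ)) * Real.exp (t * (δ / 4)) ≤
      Real.exp (-(δ * t) / 2) * Real.exp (u t) := by
    rw [← Real.exp_add, ← Real.exp_add]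
    exact Real.exp_le_exp.2 (by nlinarith)
  have h7 : 1 ≤ k / 2 * Real.exp (t * (δ / 4)) := by
    rw [div_le_iff₀ hk] at h4
    linarith
  calc Real.exp (t * (m - δ)) ≤ Real.exp (t * (m - δ)) * (k / 2 * Real.exp (t * (δ / 4))) :=
        le_mul_of_one_le_right (Real.exp_pos _).le h7
    _ = k / 2 * (Real.exp (t * (m - δ)) * Real.exp (t * (δ / 4))) := by ring
    _ ≤ k / 2 * (Real.exp (-(δ * t) / 2) * Real.exp (u t)) := by gcongr
    _ = k * (Real.exp (-(δ * t) / 2) * (Real.exp (u t) / 2)) := by ring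
    _ ≤ _ := by
      gcongr
      linarith

theorem theorem5p1
    {K : ℕ → Type*} [∀ M, NormedAddCommGroup (K M)] [∀ M, InnerProductSpace ℂ (K M)]
    [∀ M, CompleteSpace (K M)] [∀ M, FiniteDimensional ℂ (K M)]
    (Q : ∀ M, FiniteQuantumSystem (K M))
    {O : Type*} [CStarAlgebra O] (τ : ℝ → (O ≃⋆ₐ[ℂ] O)) (ω : O →ₗ[ℂ] ℂ)
    (π : ∀ M, (K M →L[ℂ] K M) →⋆ₙₐ[ℂ] O)
    (hTD : IsThermodynamicLimit Q τ ω π)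
    (hTRI : ∀ M, (Q M).IsTRI)
    -- the limiting functionals `e t α` of `e_{M,2,t}(α)` as `M → ∞`
    (e : ℝ → ℝ → ℝ)
    (he : ∀ t α, Tendsto (fun M => (Q M).entropicPressure 2 t α) atTop (𝓝 (e t α)))
    -- the large time limit on an open interval containing `[0,1]`, and its differentiability
    (I : Set ℝ) (hIopen : IsOpen I) (hIconn : I.OrdConnected) (hI : Set.Icc 0 1 ⊆ I)
    (ePlus : ℝ → ℝ)
    (hePlus : ∀ α ∈ I, Tendsto (fun t => (1 / t) * e t α) atTop (𝓝 (ePlus α)))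
    (hdiff : DifferentiableOn ℝ ePlus I) :
    (∀ p ∈ Set.Ioo (0 : ℝ) 1,
      lowerChernoff Q p = ((sInf (ePlus '' Set.Icc 0 1) : ℝ) : EReal) ∧
      upperChernoff Q p = ((sInf (ePlus '' Set.Icc 0 1) : ℝ) : EReal)) ∧
    IsLeast (ePlus '' Set.Icc 0 1) (ePlus (1 / 2)) := by
  have hI_nhds {α : ℝ} (hα : α ∈ I) : I ∈ 𝓝 α := hIopen.mem_nhds hα
  have hhalf : (1 / 2 : ℝ) ∈ I := hI (by norm_num)
  -- Minimality is needed on all of `I`, not only on `[0, 1]`: it feeds the local minimum used for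
  -- the lower bound.
  have hmin (α : ℝ) (hα : α ∈ I) : ePlus (1 / 2) ≤ ePlus α := by
    refine le_of_tendsto_of_tendsto (hePlus _ hhalf) (hePlus α hα) ?_
    filter_upwards [eventually_gt_atTop 0] with t ht
    exact mul_le_mul_of_nonneg_left (le_of_tendsto_of_tendsto' (he t _) (he t α)
      fun M => (hTRI M).entropicPressure_two_half_le t α) (by positivity)
  have hleast : IsLeast (ePlus '' Set.Icc 0 1) (ePlus (1 / 2)) := by
    refine ⟨⟨1 / 2, by norm_num, rfl⟩, ?_⟩
    rintro _ ⟨α, hα, rfl⟩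
    exact hmin α (hI hα)
  refine ⟨fun p hp => ?_, hleast⟩
  rw [hleast.csInf_eq]
  have hp' : p ∈ Set.Icc (0 : ℝ) 1 := Set.Ioo_subset_Icc_self hp
  have hexp (t α : ℝ) := (Real.continuous_exp.tendsto _).comp (he t α)
  -- Real `liminf` and `limsup` take default values on unbounded sequences; these two bounds rule
  -- that out.
  have hbelow (t : ℝ) : IsBoundedUnder (· ≥ ·) atTop fun M => (Q M).arrowError p t :=
    isBoundedUnder_of ⟨0, fun M => (Q M).arrowError_nonneg hp' t⟩
  have habove (t : ℝ) : IsBoundedUnder (· ≤ ·) atTop fun M => (Q M).arrowError p t :=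
    (hexp t (1 / 2)).isBoundedUnder_le.mono_le
      (Eventually.of_forall fun M => (Q M).arrowError_le hp' t)
  have hupper (t : ℝ) : limsup (fun M => (Q M).arrowError p t) atTop ≤ Real.exp (e t (1 / 2)) := by
    rw [← (hexp t (1 / 2)).limsup_eq]
    exact limsup_le_limsup (Eventually.of_forall fun M => (Q M).arrowError_le hp' t)
      (hbelow t).isCoboundedUnder_le (hexp t (1 / 2)).isBoundedUnder_le
  have hlower (t s : ℝ) (hs : 0 ≤ s) (c : ℝ) :
      min p (1 - p) / 2 * (Real.exp (-c / 2) * (Real.exp (e t (1 / 2)) -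
        Real.exp (-(s * c)) * (2 * Real.exp (e t (1 / 2 + s))))) ≤
      liminf (fun M => (Q M).arrowError p t) atTop := by
    have hlim := ((((hexp t (1 / 2)).sub (((hexp t (1 / 2 + s)).const_mul 2).const_mul
      (Real.exp (-(s * c))))).const_mul (Real.exp (-c / 2))).const_mul (min p (1 - p) / 2))
    rw [← hlim.liminf_eq]
    exact liminf_le_liminf (Eventually.of_forall fun M => (hTRI M).le_arrowError hp' t hs c)
      hlim.isBoundedUnder_ge (habove t).isCoboundedUnder_ge
  have hle : lowerChernoff Q p ≤ upperChernoff Q p := by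
    refine le_trans (liminf_le_liminf ?_) liminf_le_limsup
    filter_upwards [eventually_gt_atTop 0] with t ht
    exact one_div_mul_log_ofReal_mono ht (liminf_le_limsup (habove t) (hbelow t))
  have hup : upperChernoff Q p ≤ (ePlus (1 / 2) : EReal) := by
    rw [← ((continuous_coe_real_ereal.tendsto _).comp (hePlus _ hhalf)).limsup_eq]
    refine limsup_le_limsup ?_
    filter_upwards [eventually_gt_atTop 0] with t ht
    refine (one_div_mul_log_ofReal_mono ht (hupper t)).trans ?_
    rw [one_div_mul_log_ofReal (Real.exp_pos _), Real.log_exp]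
    rfl
  have hlow : (ePlus (1 / 2) : EReal) ≤ lowerChernoff Q p := by
    -- For real `b` below the minimum, `δ` is the gap, so the rate `ePlus (1 / 2) - δ` is exactly
    -- `b`.
    refine EReal.ge_of_forall_gt_iff_ge.1 fun b hb => ?_
    have hδ : 0 < ePlus (1 / 2) - b := sub_pos.2 (EReal.coe_lt_coe_iff.1 hb)
    obtain ⟨s, hs, hsI, hsle⟩ := exists_le_add_mul_of_isLocalMin (hI_nhds hhalf)
      (hdiff.differentiableAt (hI_nhds hhalf))
      (Filter.mem_of_superset (hI_nhds hhalf) hmin) (div_pos hδ four_pos)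
    have hk : 0 < min p (1 - p) / 2 := half_pos (lt_min hp.1 (sub_pos.2 hp.2))
    refine le_liminf_of_le (h := ?_)
    filter_upwards [eventually_gt_atTop 0, eventually_exp_le_of_lower_bound hk hδ hs
      (hePlus _ hhalf) (hePlus _ hsI) hsle] with t ht h
    refine le_trans (le_of_eq ?_)
      (one_div_mul_log_ofReal_mono ht (h.trans (hlower t s hs.le _)))
    rw [one_div_mul_log_ofReal (Real.exp_pos _), Real.log_exp, sub_sub_cancel, one_div,
      inv_mul_cancel_left₀ ht.ne']
  exact ⟨le_antisymm (hle.trans hup) hlow, le_antisymm hup (hlow.trans hle)⟩
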